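/- Let $n\ge 1$ and $l\ge 2$ be integers and let $M>0$; write $\mathcal L$ for Lebesgue measure. There exist a constant $K>0$ and a positive function $\eta$ on $(0,\infty)$ with $\lim_{\delta\to 0^+}\eta(\delta)=0$, both depending only on $n$, $l$ and $M$, with the following property. Let $B_1,\dots,B_l$ be balls of positive finite radius in $\mathbb R^n$ such that $\mathcal L(B_i)\le M\,\mathcal L(B_j)$ for all $i,j\in\{1,\dots,l\}$. Let $f_1,\dots,f_l:\mathbb R^n\to\mathbb C$ be Lebesgue measurable functions and let $f_{l+1}:\mathbb R^n\to\mathbb C$ be a function. Let $\tau\in(0,\infty)$ and $\delta\in(0,1]$, and suppose that $$\Bigl|f_{l+1}(x_1+\dots+x_l)-\sum_{i=1}^{l}f_i(x_i)\Bigr|\le\tau$$ for all $(x_1,\dots,x_l)\in B_1\times\dots\times B_l$ outside a subset of measure at most $\delta\prod_{i=1}^{l}\mathcal L(B_i)$. Then there exists a (real-)affine function $a:\mathbb R^n\to\mathbb C$ such that $$|f_1(x)-a(x)|\le K\tau$$ for all $x\in B_1$ outside a subset of measure at most $K\,\eta(\delta)\,\mathcal L(B_1)$. -/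

import Mathlib

open MeasureTheory Filter Topology

/-! Moving `d` from the second variable to the first keeps the sum fixed, so `f_{l+1}` cancels and
the increment `f₁(z + d) - f₁(z)` is nearly independent of `z`. Fibre measures and Markov's
inequality make this precise on a set `E` filling `B₁` up to a proportion `O(δ)`
(`exists_quadrilateral_set`). The common increment `φ d` is then almost additive for small `d`. It
is bounded because `f₁` is bounded off a small set, so a Hyers–Ulam argument puts it near a linear
`L` (`exists_linearMap_of_second_difference`). Hence `f₁ - L` oscillates by `O(τ)` at a small scale
on `E`, and a chain of boundedly many steps carries this to all of `E`
(`exists_norm_sub_le_of_local`). The function `η δ = δ` suffices: if `K * δ ≥ 1` the whole ball may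
be exceptional. -/

/-! ### Stability of additive functions -/

/-- A bounded, almost additive function on `[0, ρ]` is close to a linear one. -/
theorem norm_sub_smul_le_of_almost_additive {ρ ε N : ℝ} (hρ : 0 < ρ) {ψ : ℝ → ℂ}
    (hadd : ∀ s t, 0 ≤ s → 0 ≤ t → s + t ≤ ρ → ‖ψ (s + t) - ψ s - ψ t‖ ≤ ε)
    (hN : ∀ t, 0 ≤ t → t ≤ ρ → ‖ψ t‖ ≤ N) {t : ℝ} (ht : 0 ≤ t) (htρ : t ≤ ρ) :
    ‖ψ t - (t / ρ) • ψ ρ‖ ≤ 3 * ε := by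
  set u : ℝ → ℂ := fun t => ψ t - (t / ρ) • ψ ρ with hu
  have huadd : ∀ s t, 0 ≤ s → 0 ≤ t → s + t ≤ ρ → ‖u (s + t) - u s - u t‖ ≤ ε := by
    intro s t hs ht hst
    have : u (s + t) - u s - u t = ψ (s + t) - ψ s - ψ t := by
      simp only [hu, add_div, add_smul]; abel
    rw [this]; exact hadd s t hs ht hst
  have huρ : u ρ = 0 := by simp only [hu, div_self hρ.ne', one_smul, sub_self]
  have hbdd : ∀ t, 0 ≤ t → t ≤ ρ → ‖u t‖ ≤ 2 * N := by
    intro t ht htρ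
    have h1 := hN t ht htρ
    have h2 := hN ρ hρ.le le_rfl
    have h3 : ‖(t / ρ) • ψ ρ‖ ≤ N := by
      rw [norm_smul, Real.norm_of_nonneg (by positivity)]
      calc t / ρ * ‖ψ ρ‖ ≤ 1 * ‖ψ ρ‖ := by
            gcongr; exact (div_le_one hρ).2 htρ
        _ ≤ N := by simpa using h2
    calc ‖u t‖ ≤ ‖ψ t‖ + ‖(t / ρ) • ψ ρ‖ := norm_sub_le _ _
      _ ≤ 2 * N := by linarith
  -- Doubling treats `t ≤ ρ / 2`; the rest follows by reflection `t ↦ ρ - t`, as `u ρ = 0`. The map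
  -- `S ↦ (S + 3ε) / 2` contracts to `3ε`, so `N` disappears in the limit.
  have hstep : ∀ S, (∀ t, 0 ≤ t → t ≤ ρ → ‖u t‖ ≤ S) →
      ∀ t, 0 ≤ t → t ≤ ρ → ‖u t‖ ≤ (S + 3 * ε) / 2 := by
    intro S hS t ht htρ
    have hε : 0 ≤ ε := (norm_nonneg _).trans (huadd 0 0 le_rfl le_rfl (by linarith))
    have key : ∀ t, 0 ≤ t → t + t ≤ ρ → ‖u t‖ ≤ (S + ε) / 2 := by
      intro t ht htt
      have h1 := huadd t t ht ht htt
      have h2 := hS (t + t) (by linarith) htt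
      have h3 : ‖u t + u t‖ = 2 * ‖u t‖ := by rw [← two_mul, norm_mul]; simp
      have h4 : u t + u t = u (t + t) - (u (t + t) - u t - u t) := by ring
      have h5 : ‖u t + u t‖ ≤ ‖u (t + t)‖ + ‖u (t + t) - u t - u t‖ := by
        conv_lhs => rw [h4]
        exact norm_sub_le _ _
      linarith
    rcases le_total (t + t) ρ with h | h
    · linarith [key t ht h]
    · have h1 := key (ρ - t) (by linarith) (by linarith)
      have h2 := huadd t (ρ - t) ht (by linarith) (by linarith)
      rw [add_sub_cancel, huρ] at h2
      have h3 : u t = -(0 - u t - u (ρ - t)) - u (ρ - t) := by ring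
      have h4 : ‖u t‖ ≤ ‖0 - u t - u (ρ - t)‖ + ‖u (ρ - t)‖ := by
        conv_lhs => rw [h3]
        exact (norm_sub_le _ _).trans (by rw [norm_neg])
      linarith
  have hiter : ∀ k : ℕ, ∀ t, 0 ≤ t → t ≤ ρ → ‖u t‖ ≤ 2 * N * (1 / 2) ^ k + 3 * ε := by
    have hε : 0 ≤ ε := (norm_nonneg _).trans (huadd 0 0 le_rfl le_rfl (by linarith))
    intro k
    induction k with
    | zero => intro t h1 h2; have := hbdd t h1 h2; simp; linarith
    | succ k ih =>
      intro t h1 h2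
      have := hstep _ ih t h1 h2
      rw [pow_succ]; linarith
  have hlim : Tendsto (fun k : ℕ => 2 * N * (1 / 2 : ℝ) ^ k + 3 * ε) atTop (𝓝 (2 * N * 0 + 3 * ε)) :=
    ((tendsto_pow_atTop_nhds_zero_of_lt_one (by norm_num) (by norm_num)).const_mul _).add_const _
  rw [mul_zero, zero_add] at hlim
  exact ge_of_tendsto' hlim fun k => hiter k t ht htρ

/-- A bounded, almost additive function on a ball is close to a linear map. -/
theorem exists_linearMap_of_almost_additive {n : ℕ} {ρ ε N : ℝ} (hρ : 0 < ρ)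
    {φ : EuclideanSpace ℝ (Fin n) → ℂ}
    (hadd : ∀ s t, ‖s‖ ≤ ρ → ‖t‖ ≤ ρ → ‖s + t‖ ≤ ρ → ‖φ (s + t) - φ s - φ t‖ ≤ ε)
    (hN : ∀ t, ‖t‖ ≤ ρ → ‖φ t‖ ≤ N) :
    ∃ L : EuclideanSpace ℝ (Fin n) →ₗ[ℝ] ℂ, ∀ d, ‖d‖ ≤ ρ → ‖φ d - L d‖ ≤ (6 * n + 1) * ε := by
  classical
  set e : Fin n → EuclideanSpace ℝ (Fin n) := fun i => EuclideanSpace.single i 1 with he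
  have hen : ∀ (i) (t : ℝ), ‖t • e i‖ = |t| := by
    intro i t; simp [he, norm_smul]
  have h0 : ‖φ 0‖ ≤ ε := by
    have := hadd 0 0 (by simpa using hρ.le) (by simpa using hρ.le) (by simpa using hρ.le)
    simpa using this
  have haxis : ∀ i (t : ℝ), |t| ≤ ρ → ‖φ (t • e i) - (t / ρ) • φ (ρ • e i)‖ ≤ 5 * ε := by
    intro i t ht
    have hpos : ∀ t : ℝ, 0 ≤ t → t ≤ ρ → ‖φ (t • e i) - (t / ρ) • φ (ρ • e i)‖ ≤ 3 * ε := by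
      intro t ht htρ
      refine norm_sub_smul_le_of_almost_additive (ψ := fun t => φ (t • e i)) (N := N) hρ ?_ ?_ ht htρ
      · intro s t hs ht hst
        simp only [add_smul]
        refine hadd _ _ ?_ ?_ ?_
        · rw [hen, abs_of_nonneg hs]; linarith
        · rw [hen, abs_of_nonneg ht]; linarith
        · rw [← add_smul, hen, abs_of_nonneg (by linarith)]; exact hst
      · intro t ht htρ
        exact hN _ (by rw [hen, abs_of_nonneg ht]; exact htρ)
    rcases le_total 0 t with h | h
    · have := hpos t h ((le_abs_self t).trans ht)
      linarith [(norm_nonneg _).trans h0]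
    · have h1 := hpos (-t) (by linarith) ((neg_le_abs t).trans ht)
      have h2 := hadd (t • e i) ((-t) • e i) (by rwa [hen]) (by rwa [hen, abs_neg])
        (by simpa [← add_smul] using hρ.le)
      rw [← add_smul, add_neg_cancel, zero_smul] at h2
      have h3 : φ (t • e i) - (t / ρ) • φ (ρ • e i) = φ 0 - (φ 0 - φ (t • e i) - φ ((-t) • e i))
          - (φ ((-t) • e i) - (-t / ρ) • φ (ρ • e i)) := by
        rw [neg_div, neg_smul (t / ρ)]; abel
      rw [h3]
      refine (norm_sub_le _ _).trans ?_
      linarith [norm_sub_le (φ 0) (φ 0 - φ (t • e i) - φ ((-t) • e i))]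
  -- Additivity is only available inside the ball, so partial coordinate sums must stay there.
  have hnorm : ∀ (d : EuclideanSpace ℝ (Fin n)) (s : Finset (Fin n)),
      ‖∑ i ∈ s, d i • e i‖ ≤ ‖d‖ := by
    intro d s
    have hc : ∀ j, (∑ i ∈ s, d i • e i) j = if j ∈ s then d j else 0 := by
      intro j
      simp [he, Pi.single_apply]
    rw [EuclideanSpace.norm_eq, EuclideanSpace.norm_eq]
    gcongr with j
    rw [hc]; split_ifs <;> simp
  have hsum : ∀ (d : EuclideanSpace ℝ (Fin n)), ‖d‖ ≤ ρ → ∀ s : Finset (Fin n),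
      ‖φ (∑ i ∈ s, d i • e i) - ∑ i ∈ s, φ (d i • e i)‖ ≤ (s.card + 1) * ε := by
    intro d hd s
    induction s using Finset.induction_on with
    | empty => simpa using h0
    | insert a s ha ih =>
      rw [Finset.sum_insert ha, Finset.sum_insert ha, Finset.card_insert_of_notMem ha]
      have hda : ‖d a • e a‖ ≤ ρ := by
        simpa using (hnorm d {a}).trans hd
      have h1 := hadd (d a • e a) (∑ i ∈ s, d i • e i) hda ((hnorm d s).trans hd)
        (by rw [← Finset.sum_insert (f := fun i => d i • e i) ha]; exact (hnorm d _).trans hd)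
      have h2 := norm_add_le (φ (d a • e a + ∑ i ∈ s, d i • e i) - φ (d a • e a)
        - φ (∑ i ∈ s, d i • e i)) (φ (∑ i ∈ s, d i • e i) - ∑ i ∈ s, φ (d i • e i))
      rw [show φ (d a • e a + ∑ i ∈ s, d i • e i) - φ (d a • e a)
        - φ (∑ i ∈ s, d i • e i) + (φ (∑ i ∈ s, d i • e i) - ∑ i ∈ s, φ (d i • e i)) =
        φ (d a • e a + ∑ i ∈ s, d i • e i) - (φ (d a • e a) + ∑ i ∈ s, φ (d i • e i)) by ring] at h2
      push_cast
      linarith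
  refine ⟨∑ i, (EuclideanSpace.proj i : EuclideanSpace ℝ (Fin n) →L[ℝ] ℝ).toLinearMap.smulRight
    ((1 / ρ) • φ (ρ • e i)), fun d hd => ?_⟩
  have hd' : ∑ i, d i • e i = d := by
    ext j; simp [he, Pi.single_apply]
  have hL : (∑ i, (EuclideanSpace.proj i : EuclideanSpace ℝ (Fin n) →L[ℝ] ℝ).toLinearMap.smulRight
      ((1 / ρ) • φ (ρ • e i))) d = ∑ i, (d i / ρ) • φ (ρ • e i) := by
    simp [LinearMap.sum_apply, div_eq_mul_inv, mul_assoc]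
  have h1 := hsum d hd Finset.univ
  rw [hd', Finset.card_univ, Fintype.card_fin] at h1
  have h2 : ‖∑ i, φ (d i • e i) - ∑ i, (d i / ρ) • φ (ρ • e i)‖ ≤ n * (5 * ε) := by
    rw [← Finset.sum_sub_distrib]
    refine (norm_sum_le_of_le _ fun i _ => haxis i (d i) ?_).trans (by simp)
    rw [← hen i]
    simpa using (hnorm d {i}).trans hd
  rw [hL]
  refine (norm_sub_le_norm_sub_add_norm_sub _ (∑ i, φ (d i • e i)) _).trans ?_
  linarith

/-! ### Choosing points outside small sets -/

theorem exists_mem_of_measure_add_lt {α : Type*} [MeasurableSpace α] {μ : Measure α}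
    {Q A B C D : Set α} (h : μ A + μ B + μ C + μ D < μ Q) :
    ∃ y ∈ Q, y ∉ A ∧ y ∉ B ∧ y ∉ C ∧ y ∉ D := by
  by_contra! hc
  have hsub : Q ⊆ A ∪ B ∪ C ∪ D := by
    intro y hy
    by_cases hA : y ∈ A
    · simp [hA]
    by_cases hB : y ∈ B
    · simp [hB]
    by_cases hC : y ∈ C
    · simp [hC]
    simp [hc y hy hA hB hC]
  refine absurd h (not_lt.2 ((measure_mono hsub).trans ?_))
  refine (measure_union_le _ _).trans (add_le_add_left ?_ _)
  refine (measure_union_le _ _).trans (add_le_add_left ?_ _)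
  exact measure_union_le _ _

theorem ENNReal.sum_four_lt {a b c d q : ENNReal} (ha : a < q / 4) (hb : b < q / 4)
    (hc : c < q / 4) (hd : d < q / 4) : a + b + c + d < q := by
  calc a + b + c + d < q / 4 + q / 4 + q / 4 + q / 4 :=
        ENNReal.add_lt_add (ENNReal.add_lt_add (ENNReal.add_lt_add ha hb) hc) hd
    _ = 4 * (q / 4) := by ring
    _ = q := ENNReal.mul_div_cancel (by norm_num) (by norm_num)

/-- The sets where `‖f‖` exceeds `N` decrease to the empty set. This is the only use of
measurability of `f`: it supplies the qualitative bound needed for stability. -/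
theorem exists_norm_gt_measure_lt {α : Type*} [MeasurableSpace α] {μ : Measure α} {f : α → ℂ}
    (hf : AEMeasurable f μ) {s : Set α} (hs : MeasurableSet s) (hμ : μ s ≠ ⊤)
    {q : ENNReal} (hq : 0 < q) : ∃ N : ℕ, μ {x ∈ s | (N : ℝ) < ‖f x‖} < q := by
  have h : Tendsto (fun N : ℕ => μ {x ∈ s | (N : ℝ) < ‖f x‖}) atTop
      (𝓝 (μ (⋂ N : ℕ, {x ∈ s | (N : ℝ) < ‖f x‖}))) := by
    refine tendsto_measure_iInter_atTop (fun N => ?_) ?_ ⟨0, ?_⟩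
    · exact hs.nullMeasurableSet.inter (nullMeasurableSet_lt aemeasurable_const hf.norm)
    · intro a b hab x hx
      exact ⟨hx.1, lt_of_le_of_lt (by exact_mod_cast hab) hx.2⟩
    · exact ((measure_mono fun x hx => hx.1).trans_lt hμ.lt_top).ne
  have hempty : (⋂ N : ℕ, {x ∈ s | (N : ℝ) < ‖f x‖}) = ∅ := by
    ext x
    simp only [Set.mem_iInter, Set.mem_empty_iff_false, iff_false, not_forall]
    obtain ⟨N, hN⟩ := exists_nat_ge ‖f x‖
    exact ⟨N, fun hx => absurd hx.2 (not_lt.2 hN)⟩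
  rw [hempty, measure_empty] at h
  exact (h.eventually_lt_const hq).exists

/-! ### From second differences to an affine approximation -/

/-- If the second differences of `f` are small on a subset `E` of nearly full measure in a ball,
then the increments of `f` on `E` are close to those of a linear map. -/
theorem exists_linearMap_of_second_difference {n : ℕ} {f : EuclideanSpace ℝ (Fin n) → ℂ}
    (hf : AEMeasurable f volume) {c : EuclideanSpace ℝ (Fin n)} {r ρ τ : ℝ} (hρ : 0 < ρ)
    (hρr : 4 * ρ ≤ r) {E : Set (EuclideanSpace ℝ (Fin n))}
    (hE : volume (Metric.ball c r \ E) < volume (Metric.ball c ρ) / 4)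
    (hquad : ∀ d, ‖d‖ ≤ ρ → ∀ z w, z ∈ E → w ∈ E → z + d ∈ E → w + d ∈ E →
      ‖f (z + d) - f z - (f (w + d) - f w)‖ ≤ 4 * τ) :
    ∃ L : EuclideanSpace ℝ (Fin n) →ₗ[ℝ] ℂ, ∀ d, ‖d‖ ≤ ρ → ∀ z, z ∈ E → z + d ∈ E →
      ‖f (z + d) - f z - L d‖ ≤ 4 * τ + (6 * n + 1) * (12 * τ) := by
  have hρpos : 0 < volume (Metric.ball c ρ) / 4 :=
    ENNReal.div_pos (Metric.measure_ball_pos _ _ hρ).ne' (by norm_num)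
  obtain ⟨N, hN⟩ := exists_norm_gt_measure_lt hf (measurableSet_ball (x := c) (ε := r))
    measure_ball_lt_top.ne hρpos
  have htrans : ∀ (S : Set (EuclideanSpace ℝ (Fin n))) d,
      volume ((fun x => x + d) ⁻¹' S) = volume S := fun S d => measure_preimage_add_right _ _ _
  have hmem : ∀ z d : EuclideanSpace ℝ (Fin n), z ∈ Metric.ball c ρ → ‖d‖ ≤ 2 * ρ →
      z + d ∈ Metric.ball c r := by
    intro z d hz hd
    rw [mem_ball_iff_norm] at hz ⊢
    rw [add_sub_right_comm]
    linarith [norm_add_le (z - c) d]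
  have hbounded : ∀ d, ‖d‖ ≤ ρ → ∃ z, z ∈ E ∧ z + d ∈ E ∧ ‖f z‖ ≤ N ∧ ‖f (z + d)‖ ≤ N := by
    intro d hd
    obtain ⟨z, hz, h1, h2, h3, h4⟩ := exists_mem_of_measure_add_lt
      (ENNReal.sum_four_lt hE ((htrans _ d).trans_lt hE) hN ((htrans _ d).trans_lt hN))
    have hz1 : z ∈ Metric.ball c r := by simpa using hmem z 0 hz (by simp; linarith)
    have hz2 := hmem z d hz (by linarith)
    refine ⟨z, ?_, ?_, ?_, ?_⟩
    · by_contra h; exact h1 ⟨hz1, h⟩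
    · by_contra h; exact h2 ⟨hz2, h⟩
    · by_contra! h; exact h3 ⟨hz1, h⟩
    · by_contra! h; exact h4 ⟨hz2, h⟩
  have htriple : ∀ s t, ‖s‖ ≤ ρ → ‖t‖ ≤ ρ → ∃ z, z ∈ E ∧ z + s ∈ E ∧ z + s + t ∈ E := by
    intro s t hs ht
    -- Only three sets are to be avoided; the fourth slot repeats the first.
    obtain ⟨z, hz, h1, h2, h3, -⟩ := exists_mem_of_measure_add_lt
      (ENNReal.sum_four_lt hE ((htrans _ s).trans_lt hE) ((htrans _ (s + t)).trans_lt hE) hE)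
    refine ⟨z, ?_, ?_, ?_⟩
    · by_contra h; exact h1 ⟨by simpa using hmem z 0 hz (by simp; linarith), h⟩
    · by_contra h; exact h2 ⟨hmem z s hz (by linarith), h⟩
    · by_contra h
      exact h3 ⟨hmem z (s + t) hz (by linarith [norm_add_le s t]), by simpa only [← add_assoc] using h⟩
  choose! p hp using hbounded
  set φ : EuclideanSpace ℝ (Fin n) → ℂ := fun d => f (p d + d) - f (p d) with hφ
  have hφE : ∀ d, ‖d‖ ≤ ρ → ∀ z, z ∈ E → z + d ∈ E → ‖f (z + d) - f z - φ d‖ ≤ 4 * τ :=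
    fun d hd z hz hzd => hquad d hd z (p d) hz (hp d hd).1 hzd (hp d hd).2.1
  -- The defect `12 * τ` is three errors `4 * τ`, for the increments `s`, `t` and `s + t` along one
  -- triple in `E`.
  obtain ⟨L, hL⟩ := exists_linearMap_of_almost_additive (φ := φ) (ε := 12 * τ) (N := N + N) hρ
    (by
      intro s t hs ht hst
      obtain ⟨z, hz, hzs, hzst⟩ := htriple s t hs ht
      have h1 := hφE s hs z hz hzs
      have h2 := hφE t ht (z + s) hzs hzst
      have h3 := hφE (s + t) hst z hz (by rwa [← add_assoc])
      rw [← add_assoc] at h3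
      have h4 : φ (s + t) - φ s - φ t = (f (z + s) - f z - φ s) + (f (z + s + t) - f (z + s) - φ t)
          - (f (z + s + t) - f z - φ (s + t)) := by ring
      rw [h4]
      refine (norm_sub_le _ _).trans ?_
      linarith [norm_add_le (f (z + s) - f z - φ s) (f (z + s + t) - f (z + s) - φ t)])
    (fun t ht => (norm_sub_le _ _).trans (add_le_add (hp t ht).2.2.2 (hp t ht).2.2.1))
  refine ⟨L, fun d hd z hz hzd => ?_⟩
  exact (norm_sub_le_norm_sub_add_norm_sub _ (φ d) _).trans (add_le_add (hφE d hd z hz hzd) (hL d hd))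

/-- A function with small local oscillation on a subset `E` of nearly full measure in a ball has
small oscillation on `E`. -/
theorem exists_norm_sub_le_of_local {n : ℕ} {F : EuclideanSpace ℝ (Fin n) → ℂ}
    {c : EuclideanSpace ℝ (Fin n)} {r σ A : ℝ} (hσ : 0 < σ) (hσr : σ ≤ r)
    {E : Set (EuclideanSpace ℝ (Fin n))} (hEr : E ⊆ Metric.ball c r)
    (hE : volume (Metric.ball c r \ E) < volume (Metric.ball c σ))
    (hloc : ∀ z ∈ E, ∀ w ∈ E, ‖z - w‖ ≤ 3 * σ → ‖F z - F w‖ ≤ A)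
    {k : ℕ} (hk : r ≤ (k + 2) * σ) : ∃ b : ℂ, ∀ z ∈ E, ‖F z - b‖ ≤ (k + 1) * A := by
  have hfind : ∀ q, Metric.ball q σ ⊆ Metric.ball c r → ∃ z ∈ E, ‖z - q‖ < σ := by
    intro q hq
    by_contra! h
    have hsub : Metric.ball q σ ⊆ Metric.ball c r \ E := fun x hx =>
      ⟨hq hx, fun hxE => absurd (mem_ball_iff_norm.1 hx) (not_lt.2 (h x hxE))⟩
    refine absurd hE (not_lt.2 ?_)
    rw [Measure.addHaar_ball_center volume c, ← Measure.addHaar_ball_center volume q]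
    exact measure_mono hsub
  obtain ⟨z₀, hz₀, hz₀σ⟩ := hfind c (Metric.ball_subset_ball hσr)
  have key : ∀ k : ℕ, ∀ z ∈ E, ‖z - c‖ < (k + 2) * σ → ‖F z - F z₀‖ ≤ (k + 1) * A := by
    intro k
    induction k with
    | zero =>
      intro z hz hzc
      simp only [Nat.cast_zero, zero_add, one_mul] at hzc ⊢
      refine hloc z hz z₀ hz₀ ?_
      have h := norm_sub_le (z - c) (z₀ - c)
      rw [sub_sub_sub_cancel_right] at h
      linarith
    | succ k ih =>
      intro z hz hzc
      push_cast at hzc ⊢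
      have hA : 0 ≤ A := (norm_nonneg _).trans (hloc z hz z hz (by simp; linarith))
      rcases lt_or_ge ‖z - c‖ (((k : ℝ) + 2) * σ) with h | h
      · exact (ih z hz h).trans (by linarith)
      have hkσ : 0 ≤ (k : ℝ) * σ := by positivity
      have hzpos : 0 < ‖z - c‖ := by linarith
      have hzr : ‖z - c‖ < r := mem_ball_iff_norm.1 (hEr hz)
      set θ : ℝ := 2 * σ / ‖z - c‖ with hθ
      have hθ0 : 0 ≤ θ := by positivity
      have hθ1 : θ ≤ 1 := (div_le_one hzpos).2 (by linarith)
      have hθz : θ * ‖z - c‖ = 2 * σ := div_mul_cancel₀ _ hzpos.ne'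
      -- The point of the segment from `z` to `c` at distance `2σ` from `z`. A point `w` of `E`
      -- within `σ` of `q` is within `3σ` of `z` and nearer to `c` by more than `σ`.
      set q := c + (1 - θ) • (z - c) with hq
      have hqc : ‖q - c‖ = ‖z - c‖ - 2 * σ := by
        rw [hq, add_sub_cancel_left, norm_smul, Real.norm_of_nonneg (by linarith), sub_mul, hθz,
          one_mul]
      have hzq : ‖z - q‖ = 2 * σ := by
        rw [show z - q = θ • (z - c) by rw [hq, sub_smul, one_smul]; abel, norm_smul,
          Real.norm_of_nonneg hθ0, hθz]
      obtain ⟨w, hw, hwq⟩ := hfind q (by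
        intro x hx
        rw [mem_ball_iff_norm] at hx ⊢
        have := norm_sub_le_norm_sub_add_norm_sub x q c
        linarith)
      have h1 : ‖w - c‖ < (k + 2) * σ := by
        have := norm_sub_le_norm_sub_add_norm_sub w q c
        linarith
      have h2 : ‖z - w‖ ≤ 3 * σ := by
        have := norm_sub_le_norm_sub_add_norm_sub z q w
        rw [norm_sub_rev q w] at this
        linarith
      have h3 := norm_sub_le_norm_sub_add_norm_sub (F z) (F w) (F z₀)
      linarith [ih w hw h1, hloc z hz w hw h2]
  exact ⟨F z₀, fun z hz => key k z hz ((mem_ball_iff_norm.1 (hEr hz)).trans_le hk)⟩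

/-! ### Eliminating the other functions -/

/-- Near-additivity on a product of balls forces small second differences of the first function
on a set of nearly full measure. -/
theorem exists_quadrilateral_set {n k : ℕ} {c : Fin (k + 2) → EuclideanSpace ℝ (Fin n)}
    {r : Fin (k + 2) → ℝ} (hr : ∀ i, 0 < r i) {g : EuclideanSpace ℝ (Fin n) → ℂ}
    {f : Fin (k + 2) → EuclideanSpace ℝ (Fin n) → ℂ} {τ δ : ℝ}
    (h : volume {x : Fin (k + 2) → EuclideanSpace ℝ (Fin n) |
        (∀ i, x i ∈ Metric.ball (c i) (r i)) ∧ ¬ ‖g (∑ i, x i) - ∑ i, f i (x i)‖ ≤ τ} ≤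
      ENNReal.ofReal δ * ∏ i, volume (Metric.ball (c i) (r i))) :
    ∃ E ⊆ Metric.ball (c 0) (r 0),
      volume (Metric.ball (c 0) (r 0) \ E) ≤
        ENNReal.ofReal (4 * (2 ^ n) ^ (k + 1) * δ) * volume (Metric.ball (c 0) (r 0)) ∧
      ∀ d, ‖d‖ ≤ r 1 / 2 → ∀ z w, z ∈ E → w ∈ E → z + d ∈ E → w + d ∈ E →
        ‖f 0 (z + d) - f 0 z - (f 0 (w + d) - f 0 w)‖ ≤ 4 * τ := by
  set S := {x : Fin (k + 2) → EuclideanSpace ℝ (Fin n) |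
        (∀ i, x i ∈ Metric.ball (c i) (r i)) ∧ ¬ ‖g (∑ i, x i) - ∑ i, f i (x i)‖ ≤ τ} with hS
  have hmp := (volume_preserving_piFinSuccAbove
    (fun _ : Fin (k + 2) => EuclideanSpace ℝ (Fin n)) 0).symm
  set e := (MeasurableEquiv.piFinSuccAbove
    (fun _ : Fin (k + 2) => EuclideanSpace ℝ (Fin n)) 0).symm with he
  have hecons : ∀ (z : EuclideanSpace ℝ (Fin n)) (y : Fin (k + 1) → EuclideanSpace ℝ (Fin n)),
      e (z, y) = Fin.cons z y := by
    intro z y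
    simp [he, MeasurableEquiv.piFinSuccAbove, Fin.insertNthEquiv]
  -- `g` is arbitrary, so `S` need not be measurable; its measurable hull has the same measure.
  set T : Set (EuclideanSpace ℝ (Fin n) × (Fin (k + 1) → EuclideanSpace ℝ (Fin n))) :=
    e ⁻¹' toMeasurable volume S with hT
  have hTm : MeasurableSet T := e.measurable (measurableSet_toMeasurable _ _)
  have hTvol : volume T = volume S := by
    rw [hT, hmp.measure_preimage_equiv, measure_toMeasurable]
  set β : EuclideanSpace ℝ (Fin n) → ENNReal := fun z => volume (Prod.mk z ⁻¹' T) with hβ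
  have hβm : Measurable β := measurable_measure_prodMk_left hTm
  have hβint : ∫⁻ z, β z = volume S := by
    rw [← hTvol, Measure.volume_eq_prod, Measure.prod_apply hTm]
  set P : ENNReal := ∏ j : Fin (k + 1), volume (Metric.ball (c j.succ) (r j.succ)) with hP
  -- Halved radii leave room to shift by `d`, at the cost of a factor `2 ^ n` per ball.
  set Q : Set (Fin (k + 1) → EuclideanSpace ℝ (Fin n)) :=
    Set.univ.pi fun j => Metric.ball (c j.succ) (r j.succ / 2) with hQ
  have hQP : volume Q * ENNReal.ofReal ((2 ^ n) ^ (k + 1)) = P := by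
    rw [hQ, volume_pi_pi, hP, ENNReal.ofReal_pow (by positivity)]
    have h2 : ENNReal.ofReal (2 ^ n) ^ (k + 1) = ∏ _j : Fin (k + 1), ENNReal.ofReal (2 ^ n) := by
      simp
    rw [h2, ← Finset.prod_mul_distrib]
    refine Finset.prod_congr rfl fun j _ => ?_
    rw [Measure.addHaar_ball_of_pos volume (c j.succ) (by linarith [hr j.succ]),
      Measure.addHaar_ball_of_pos volume (c j.succ) (hr j.succ), mul_right_comm,
      ← ENNReal.ofReal_mul (by have := hr j.succ; positivity), finrank_euclideanSpace_fin,
      div_pow, div_mul_cancel₀ _ (by positivity)]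
  have hQ0 : volume Q ≠ 0 := by
    rw [hQ, volume_pi_pi]
    exact Finset.prod_ne_zero_iff.2 fun j _ =>
      (Metric.measure_ball_pos _ _ (by linarith [hr j.succ])).ne'
  have hQtop : volume Q ≠ ⊤ := by
    rw [hQ, volume_pi_pi]
    exact ENNReal.prod_ne_top fun j _ => measure_ball_lt_top.ne
  have hgood : ∀ z ∈ Metric.ball (c 0) (r 0), ∀ y : Fin (k + 1) → EuclideanSpace ℝ (Fin n),
      (∀ j, y j ∈ Metric.ball (c j.succ) (r j.succ)) → (z, y) ∉ T →
      ‖g (z + ∑ j, y j) - (f 0 z + ∑ j, f j.succ (y j))‖ ≤ τ := by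
    intro z hz y hy hzy
    by_contra hc
    refine hzy (subset_toMeasurable _ _ ?_)
    rw [hecons]
    refine ⟨Fin.cases (by simpa using hz) (by simpa using hy), ?_⟩
    simpa [Fin.sum_univ_succ] using hc
  -- The threshold `1 / 4` lets one `y` serve the four pairs `(z, y + s)`, `(z + d, y)`, `(w, y +
  -- s)`, `(w + d, y)`.
  refine ⟨{z ∈ Metric.ball (c 0) (r 0) | β z < volume Q / 4}, fun z hz => hz.1, ?_, ?_⟩
  · have hsub : Metric.ball (c 0) (r 0) \ {z ∈ Metric.ball (c 0) (r 0) | β z < volume Q / 4} ⊆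
        {z | volume Q / 4 ≤ β z} := fun z hz => not_lt.1 fun hlt => hz.2 ⟨hz.1, hlt⟩
    have hq0 : volume Q / 4 ≠ 0 := (ENNReal.div_pos hQ0 (by norm_num)).ne'
    have hqtop : volume Q / 4 ≠ ⊤ := (ENNReal.div_lt_top hQtop (by norm_num)).ne
    refine (measure_mono hsub).trans ?_
    have hcheb := (mul_meas_ge_le_lintegral (μ := volume) hβm (volume Q / 4)).trans
      (hβint.trans_le h)
    rw [Fin.prod_univ_succ, ← hP, ← hQP] at hcheb
    refine (ENNReal.mul_le_mul_iff_right hq0 hqtop).1 (hcheb.trans_eq ?_)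
    have h4 : volume Q / 4 * 4 = volume Q := ENNReal.div_mul_cancel (by norm_num) (by norm_num)
    rw [ENNReal.ofReal_mul (by positivity), ENNReal.ofReal_mul (by norm_num),
      ENNReal.ofReal_ofNat]
    conv_lhs => rw [← h4]
    ring
  · rintro d hd z w ⟨hz, hβz⟩ ⟨hw, hβw⟩ ⟨hzd, hβzd⟩ ⟨hwd, hβwd⟩
    set s : Fin (k + 1) → EuclideanSpace ℝ (Fin n) := Pi.single 0 d with hs
    have htrans : ∀ z, volume ((fun y => y + s) ⁻¹' (Prod.mk z ⁻¹' T)) = β z :=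
      fun z => measure_preimage_add_right _ _ _
    obtain ⟨y, hy, h1, h2, h3, h4⟩ := exists_mem_of_measure_add_lt
      (ENNReal.sum_four_lt ((htrans z).trans_lt hβz) hβzd ((htrans w).trans_lt hβw) hβwd)
    have hyb : ∀ j, y j ∈ Metric.ball (c j.succ) (r j.succ) := fun j =>
      Metric.ball_subset_ball (by linarith [hr j.succ]) (hy j trivial)
    have hysb : ∀ j, (y + s) j ∈ Metric.ball (c j.succ) (r j.succ) := by
      intro j
      by_cases hj : j = 0
      · subst hj
        have hy0 := mem_ball_iff_norm.1 (hy 0 trivial)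
        rw [mem_ball_iff_norm, Pi.add_apply, hs, Pi.single_eq_same, add_sub_right_comm]
        have := norm_add_le (y 0 - c (Fin.succ 0)) d
        rw [Fin.succ_zero_eq_one] at *
        linarith
      · simpa [hs, Pi.single_eq_of_ne hj] using hyb j
    have hsum : ∀ z : EuclideanSpace ℝ (Fin n), z + ∑ j, (y + s) j = z + d + ∑ j, y j := by
      intro z
      simp only [Pi.add_apply, Finset.sum_add_distrib, hs, Finset.sum_pi_single', Finset.mem_univ,
        if_true]
      abel
    have a1 := hgood z hz _ hysb h1
    have a2 := hgood _ hzd y hyb h2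
    have a3 := hgood w hw _ hysb h3
    have a4 := hgood _ hwd y hyb h4
    rw [hsum] at a1 a3
    generalize ∑ j, f j.succ ((y + s) j) = H' at a1 a3
    generalize ∑ j, f j.succ (y j) = H at a2 a4
    generalize g (z + d + ∑ j, y j) = G₁ at a1 a2
    generalize g (w + d + ∑ j, y j) = G₂ at a3 a4
    have heq : f 0 (z + d) - f 0 z - (f 0 (w + d) - f 0 w) =
        ((G₁ - (f 0 z + H')) - (G₁ - (f 0 (z + d) + H)))
          - ((G₂ - (f 0 w + H')) - (G₂ - (f 0 (w + d) + H))) := by ring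
    rw [heq]
    refine (norm_sub_le _ _).trans ?_
    linarith [norm_sub_le (G₁ - (f 0 z + H')) (G₁ - (f 0 (z + d) + H)),
      norm_sub_le (G₂ - (f 0 w + H')) (G₂ - (f 0 (w + d) + H))]

/-! ### Comparable radii and the final assembly -/

/-- Since `n ≥ 1`, `max M 1 ≤ (max M 1) ^ n`; this avoids extracting an `n`-th root of `M`. -/
theorem radius_le_of_volume_ball_le {n : ℕ} (hn : 1 ≤ n) {c c' : EuclideanSpace ℝ (Fin n)}
    {r r' M : ℝ} (hr : 0 < r) (hr' : 0 < r')
    (h : volume (Metric.ball c r) ≤ ENNReal.ofReal M * volume (Metric.ball c' r')) :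
    r ≤ max M 1 * r' := by
  rw [Measure.addHaar_ball_of_pos volume c hr, Measure.addHaar_ball_of_pos volume c' hr', ← mul_assoc,
    finrank_euclideanSpace_fin, ENNReal.mul_le_mul_iff_left
      (Metric.measure_ball_pos _ _ one_pos).ne' measure_ball_lt_top.ne,
    ← ENNReal.ofReal_mul' (by positivity)] at h
  have hpos : 0 < M * r' ^ n := by
    by_contra! hc
    rw [ENNReal.ofReal_of_nonpos hc, nonpos_iff_eq_zero, ENNReal.ofReal_eq_zero] at h
    exact absurd (pow_pos hr n) (not_lt.2 h)
  rw [ENNReal.ofReal_le_ofReal_iff hpos.le] at h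
  by_contra! hc
  have h1 : max M 1 * r' ^ n ≤ (max M 1 * r') ^ n := by
    rw [mul_pow]
    gcongr
    exact le_self_pow₀ (le_max_right _ _) (by omega)
  have h2 : (max M 1 * r') ^ n < r ^ n :=
    pow_lt_pow_left₀ hc (by positivity) (by omega)
  have h3 : M * r' ^ n ≤ max M 1 * r' ^ n := by gcongr; exact le_max_left _ _
  linarith

/-- `f 0, …, f (l - 1)` are the functions `f₁, …, f_l` (Lebesgue measurable, that is,
a.e.-measurable for `volume`), and `f (Fin.last l)` is `f_{l+1}`.  The constant `K` and the function
`η` depend only on the dimension `n`, the number `l` of balls and the comparability constant `M`. -/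
theorem proposition9p2 (n l : ℕ) (_hn : 1 ≤ n) (hl : 2 ≤ l) (M : ℝ) :
    ∃ (K : ℝ) (η : ℝ → ℝ), 0 < K ∧ (∀ δ : ℝ, 0 < δ → 0 < η δ) ∧ Tendsto η (𝓝[>] 0) (𝓝 0) ∧
      ∀ (c : Fin l → EuclideanSpace ℝ (Fin n)) (r : Fin l → ℝ),
        (∀ i, 0 < r i) →
        (∀ i j, volume (Metric.ball (c i) (r i)) ≤
          ENNReal.ofReal M * volume (Metric.ball (c j) (r j))) →
        ∀ f : Fin (l + 1) → EuclideanSpace ℝ (Fin n) → ℂ,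
          (∀ i : Fin l, AEMeasurable (f i.castSucc) volume) →
          ∀ τ δ : ℝ, 0 < τ → 0 < δ → δ ≤ 1 →
            volume {x : Fin l → EuclideanSpace ℝ (Fin n) |
                (∀ i, x i ∈ Metric.ball (c i) (r i)) ∧
                  ¬ ‖f (Fin.last l) (∑ i, x i) - ∑ i : Fin l, f i.castSucc (x i)‖ ≤ τ} ≤
              ENNReal.ofReal δ * ∏ i, volume (Metric.ball (c i) (r i)) →
            ∃ a : EuclideanSpace ℝ (Fin n) →ᵃ[ℝ] ℂ,
              volume {x | x ∈ Metric.ball (c ⟨0, two_pos.trans_le hl⟩) (r ⟨0, two_pos.trans_le hl⟩) ∧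
                  ¬ ‖f 0 x - a x‖ ≤ K * τ} ≤
                ENNReal.ofReal (K * η δ) *
                  volume (Metric.ball (c ⟨0, two_pos.trans_le hl⟩) (r ⟨0, two_pos.trans_le hl⟩)) := by
  obtain ⟨k, rfl⟩ : ∃ k, l = k + 2 := ⟨l - 2, by omega⟩
  set R : ℝ := max M 1 with hR
  have hR1 : 1 ≤ R := le_max_right _ _
  obtain ⟨m, hm⟩ := exists_nat_ge (12 * R)
  set C : ℝ := 4 * (2 ^ n) ^ (k + 1) with hC
  have hC0 : 0 < C := by positivity
  set A : ℝ := 4 + (6 * n + 1) * 12 with hA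
  -- With `K * δ < 1`, the first summand makes the complement of `E` smaller than a quarter of a
  -- ball of radius `σ`. The second bounds the exceptional measure, the third the error after
  -- chaining.
  set K : ℝ := 4 * C * (12 * R) ^ n + C + (m + 1) * A with hK
  have hA0 : 0 < A := by positivity
  have hK1 : 4 * C * (12 * R) ^ n < K := by
    have : 0 < (m + 1) * A := by positivity
    linarith
  have hK2 : C ≤ K := by
    have : 0 < (m + 1) * A := by positivity
    have : 0 < 4 * C * (12 * R) ^ n := by positivity
    linarith
  have hK3 : (m + 1) * A ≤ K := by
    have : 0 < 4 * C * (12 * R) ^ n := by positivity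
    linarith
  have hK0 : 0 < K := hC0.trans_le hK2
  refine ⟨K, fun δ => δ, hK0, fun δ h => h, tendsto_nhdsWithin_of_tendsto_nhds tendsto_id, ?_⟩
  intro c r hr hM f hf τ δ hτ hδ hδ1 hbad
  change ∃ a : EuclideanSpace ℝ (Fin n) →ᵃ[ℝ] ℂ,
    volume {x | x ∈ Metric.ball (c 0) (r 0) ∧ ¬ ‖f 0 x - a x‖ ≤ K * τ} ≤
      ENNReal.ofReal (K * δ) * volume (Metric.ball (c 0) (r 0))
  rcases le_or_gt 1 (K * δ) with hKδ | hKδ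
  · refine ⟨0, (measure_mono fun x hx => hx.1).trans ?_⟩
    exact le_mul_of_one_le_left zero_le (ENNReal.one_le_ofReal.2 hKδ)
  obtain ⟨E, hEsub, hEvol, hquad⟩ := exists_quadrilateral_set
    (f := fun i => f i.castSucc) (g := f (Fin.last _)) hr hbad
  simp only [Fin.castSucc_zero] at hquad
  have hr01 : r 0 ≤ R * r 1 := radius_le_of_volume_ball_le _hn (hr 0) (hr 1) (hM 0 1)
  have hr0 := hr 0
  -- With `ρ = 3 * σ`, the factor 12 gives `4 * ρ ≤ r 0`, and the factor `R` gives `ρ ≤ r 1 / 2`.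
  -- This `ρ` is also the local scale of the chaining lemma.
  set σ : ℝ := r 0 / (12 * R) with hσ
  have hσ0 : 0 < σ := by positivity
  have hσR : 12 * R * σ = r 0 := mul_div_cancel₀ _ (by positivity)
  have hσr0 : 12 * σ ≤ r 0 := by nlinarith
  have hσr1 : 12 * σ ≤ r 1 := by
    have : R * (12 * σ) ≤ R * r 1 := by linarith
    exact le_of_mul_le_mul_left this (by linarith)
  have hvol : volume (Metric.ball (c 0) (r 0)) =
      ENNReal.ofReal ((12 * R) ^ n) * volume (Metric.ball (c 0) σ) := by
    rw [Measure.addHaar_ball_of_pos volume (c 0) hr0, Measure.addHaar_ball_of_pos volume (c 0) hσ0,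
      ← mul_assoc, ← ENNReal.ofReal_mul (by positivity), finrank_euclideanSpace_fin, ← mul_pow, hσR]
  have hEσ : volume (Metric.ball (c 0) (r 0) \ E) < volume (Metric.ball (c 0) σ) / 4 := by
    refine hEvol.trans_lt ?_
    rw [hvol, ← mul_assoc, ← ENNReal.ofReal_mul (by positivity), div_eq_mul_inv, mul_comm]
    refine ENNReal.mul_lt_mul_right (Metric.measure_ball_pos _ _ hσ0).ne' measure_ball_lt_top.ne ?_
    rw [← ENNReal.ofReal_ofNat 4, ← ENNReal.ofReal_inv_of_pos (by norm_num),
      ENNReal.ofReal_lt_ofReal_iff (by norm_num)]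
    have : 4 * C * (12 * R) ^ n * δ < 1 := (mul_lt_mul_of_pos_right hK1 hδ).trans hKδ
    linarith
  obtain ⟨L, hL⟩ := exists_linearMap_of_second_difference (ρ := 3 * σ) (τ := τ) (hf 0)
    (by positivity) (by linarith)
    (hEσ.trans_le (ENNReal.div_le_div_right
      (measure_mono (Metric.ball_subset_ball (by linarith))) _))
    (fun d hd => hquad d (by linarith))
  obtain ⟨b, hb⟩ := exists_norm_sub_le_of_local (F := fun z => f 0 z - L z) (A := A * τ) (k := m)
    hσ0 (by linarith) hEsub (hEσ.trans_le (ENNReal.div_le_of_le_mul (by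
      exact le_mul_of_one_le_right zero_le (by norm_num))))
    (by
      intro z hz w hw hzw
      have h := hL (z - w) hzw w hw (by rwa [add_sub_cancel])
      rw [add_sub_cancel, map_sub, Fin.castSucc_zero] at h
      rw [show f 0 z - L z - (f 0 w - L w) = f 0 z - f 0 w - (L z - L w) by ring]
      refine h.trans_eq ?_
      rw [hA]; ring)
    (by
      have : 12 * R * σ ≤ m * σ := by gcongr
      linarith)
  refine ⟨L.toAffineMap + AffineMap.const ℝ _ b, ?_⟩
  refine (measure_mono (t := Metric.ball (c 0) (r 0) \ E) ?_).trans (hEvol.trans ?_)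
  · rintro x ⟨hx, hxa⟩
    refine ⟨hx, fun hxE => hxa ?_⟩
    have h := hb x hxE
    simp only [AffineMap.coe_add, Pi.add_apply, LinearMap.coe_toAffineMap, AffineMap.const_apply]
    rw [← sub_sub]
    refine h.trans ?_
    rw [← mul_assoc]
    gcongr
  · gcongr
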